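/- Let $t \ge 1$ be an integer. For a field $K$ and $n \ge 1$, let $\mathrm{GL}_n(K)$ be the group of invertible $n \times n$ matrices over $K$, and put $\mathrm{SL}_n(K) = \{M \in \mathrm{GL}_n(K) : \det M = 1\}$, $\mathrm{O}_n(K) = \{M \in \mathrm{GL}_n(K) : M^{\mathrm{tr}} M = I_n\}$, $\mathrm{Sp}_{2n}(K) = \{M \in \mathrm{GL}_{2n}(K) : M^{\mathrm{tr}} \Omega M = \Omega\}$ with $\Omega = \begin{pmatrix} 0 & I_n \\ -I_n & 0 \end{pmatrix}$, and $\mathrm{U}_n(\mathbb{C}) = \{U \in \mathrm{GL}_n(\mathbb{C}) : U U^{*} = I_n\}$. Each group of $n \times n$ matrices over $K$ carries the Zariski topology, that is, the subspace topology from $K^{n^2}$, whose closed sets are the sets of common zeros in $K^{n^2}$ of sets of polynomials over $K$ in the $n^2$ matrix entries. Let $G$ be one of $\mathrm{GL}_t$, $\mathrm{SL}_t$, $\mathrm{O}_t$, $\mathrm{Sp}_{2t}$, and let $N$ be the size of its matrices ($N = t$ in the first three cases and $N = 2t$ in the last). Then: (a) The group $C = G(\mathbb{C}) \cap \mathrm{U}_N(\mathbb{C})$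 is compact in the Euclidean topology and is a Zariski-dense subgroup of $G(\mathbb{C})$. (b) For every field $k$ of characteristic zero, $G(\mathbb{Q})$ is a Zariski-dense subgroup of $G(k)$. -/

import Mathlib

open Matrix

namespace ClassicalDensity

/-- The Zariski topology on the affine space `K ^ σ`: the closed sets are the sets of common zeros
in `K ^ σ` of the ideals of `K[x_s : s ∈ σ]`. -/
@[reducible] def zariskiTopology (σ : Type*) (K : Type*) [Field K] : TopologicalSpace (σ → K) :=
  TopologicalSpace.ofClosed
    {Z | ∃ I : Ideal (MvPolynomial σ K), Z = MvPolynomial.zeroLocus K I}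
    ⟨⊤, by simp⟩
    (by
      intro A hA
      have hA' : ∀ Z ∈ A, ∃ I : Ideal (MvPolynomial σ K), Z = MvPolynomial.zeroLocus K I :=
        fun Z hZ => hA hZ
      choose! I hI using hA'
      refine ⟨⨆ Z ∈ A, I Z, ?_⟩
      ext x
      constructor
      · intro hx
        have h : (⨆ Z ∈ A, I Z) ≤ RingHom.ker (MvPolynomial.aeval x : MvPolynomial σ K →ₐ[K] K) := by
          refine iSup₂_le fun Z hZ p hp => ?_
          have hxZ : x ∈ Z := hx Z hZ
          rw [hI Z hZ] at hxZ
          exact hxZ p hp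
        exact fun p hp => h hp
      · intro hx Z hZ
        rw [hI Z hZ]
        exact fun p hp => hx p ((le_iSup₂ (f := fun Z (_ : Z ∈ A) => I Z) Z hZ) hp))
    (by
      rintro _ ⟨I, rfl⟩ _ ⟨J, rfl⟩
      refine ⟨I ⊓ J, ?_⟩
      ext x
      constructor
      · rintro (hx | hx) p hp
        · exact hx p hp.1
        · exact hx p hp.2
      · intro hx
        by_contra h
        simp only [Set.mem_union, MvPolynomial.mem_zeroLocus_iff, not_or, not_forall] at h
        obtain ⟨⟨p, hp, hpx⟩, q, hq, hqx⟩ := h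
        have := hx (p * q) ⟨I.mul_mem_right q hp, J.mul_mem_left p hq⟩
        rw [map_mul] at this
        exact (mul_ne_zero hpx hqx) this)

section Groups

variable (n : Type*) [Fintype n] [DecidableEq n] (K : Type*) [Field K]

/-- `GL_n(K)` as a subgroup of itself. -/
def generalLinear : Subgroup (GL n K) := ⊤

/-- `SL_n(K) = {M ∈ GL_n(K) : det M = 1}`. -/
def specialLinear : Subgroup (GL n K) where
  carrier := {M | (M : Matrix n n K).det = 1}
  one_mem' := by simp
  mul_mem' := by
    intro a b ha hb
    simp only [Set.mem_ofPred_eq] at *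
    simp [ha, hb]
  inv_mem' := by
    intro a ha
    simp only [Set.mem_ofPred_eq] at *
    simp [Matrix.det_nonsing_inv, ha]

variable {n K} in
/-- The group of all `M ∈ GL_n(K)` with `Mᵀ B M = B`. -/
def formStabilizer (B : Matrix n n K) : Subgroup (GL n K) where
  carrier := {M | (M : Matrix n n K)ᵀ * B * (M : Matrix n n K) = B}
  one_mem' := by simp
  mul_mem' := by
    intro a b ha hb
    simp only [Set.mem_ofPred_eq] at *
    calc ((a * b : GL n K) : Matrix n n K)ᵀ * B * ((a * b : GL n K) : Matrix n n K)
        = (b : Matrix n n K)ᵀ * ((a : Matrix n n K)ᵀ * B * (a : Matrix n n K)) *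
            (b : Matrix n n K) := by
          simp only [Units.val_mul, Matrix.transpose_mul, Matrix.mul_assoc]
      _ = B := by rw [ha, hb]
  inv_mem' := by
    intro a ha
    simp only [Set.mem_ofPred_eq] at *
    have h1 : (a : Matrix n n K) * ((a⁻¹ : GL n K) : Matrix n n K) = 1 := by
      rw [← Units.val_mul, mul_inv_cancel, Units.val_one]
    have h2 : ((a⁻¹ : GL n K) : Matrix n n K)ᵀ * (a : Matrix n n K)ᵀ = 1 := by
      rw [← Matrix.transpose_mul, h1, Matrix.transpose_one]
    calc ((a⁻¹ : GL n K) : Matrix n n K)ᵀ * B * ((a⁻¹ : GL n K) : Matrix n n K)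
        = ((a⁻¹ : GL n K) : Matrix n n K)ᵀ *
            ((a : Matrix n n K)ᵀ * B * (a : Matrix n n K)) *
              ((a⁻¹ : GL n K) : Matrix n n K) := by rw [ha]
      _ = (((a⁻¹ : GL n K) : Matrix n n K)ᵀ * (a : Matrix n n K)ᵀ) * B *
            ((a : Matrix n n K) * ((a⁻¹ : GL n K) : Matrix n n K)) := by
          simp only [Matrix.mul_assoc]
      _ = B := by rw [h1, h2, Matrix.one_mul, Matrix.mul_one]

/-- `O_n(K) = {M ∈ GL_n(K) : Mᵀ M = I}`. -/
def orthogonal : Subgroup (GL n K) := formStabilizer 1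

/-- `Sp_{2m}(K) = {M ∈ GL_{2m}(K) : Mᵀ Ω M = Ω}` with `Ω = [[0, I], [-I, 0]]`, where `m` is the
size of `n` and the rows and columns are indexed by two copies of `n`. -/
def symplectic : Subgroup (GL (n ⊕ n) K) := formStabilizer (Matrix.fromBlocks 0 1 (-1) 0)

/-- `U_n(ℂ) = {U ∈ GL_n(ℂ) : U U* = I}`. -/
def unitary : Subgroup (GL n ℂ) where
  carrier := {U | (U : Matrix n n ℂ) * (U : Matrix n n ℂ)ᴴ = 1}
  one_mem' := by simp
  mul_mem' := by
    intro a b ha hb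
    simp only [Set.mem_ofPred_eq] at *
    calc ((a * b : GL n ℂ) : Matrix n n ℂ) * ((a * b : GL n ℂ) : Matrix n n ℂ)ᴴ
        = (a : Matrix n n ℂ) * ((b : Matrix n n ℂ) * (b : Matrix n n ℂ)ᴴ) *
            (a : Matrix n n ℂ)ᴴ := by
          simp only [Units.val_mul, Matrix.conjTranspose_mul, Matrix.mul_assoc]
      _ = 1 := by rw [hb, Matrix.mul_one, ha]
  inv_mem' := by
    intro a ha
    simp only [Set.mem_ofPred_eq] at *
    have h1 : ((a⁻¹ : GL n ℂ) : Matrix n n ℂ) = (a : Matrix n n ℂ)ᴴ := by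
      rw [Matrix.coe_units_inv]
      exact Matrix.inv_eq_right_inv ha
    rw [h1, Matrix.conjTranspose_conjTranspose]
    exact mul_eq_one_comm.mp ha

end Groups

section Density

variable {n : Type*} [Fintype n] [DecidableEq n]

/-- The Zariski topology of a group `G` of invertible matrices: the subspace topology from the
affine space of all `n × n` matrices. -/
@[reducible] def groupZariskiTopology {K : Type*} [Field K] (G : Subgroup (GL n K)) : TopologicalSpace G :=
  (zariskiTopology (n × n) K).induced fun g p => ((g : GL n K) : Matrix n n K) p.1 p.2

/-- `H` is a Zariski-dense subgroup of `G`. -/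
def IsZariskiDenseSubgroup {K : Type*} [Field K] (H G : Subgroup (GL n K)) : Prop :=
  H ≤ G ∧ @Dense G (groupZariskiTopology G) {g : G | (g : GL n K) ∈ H}

/-- `H` is compact in the Euclidean topology of the space of complex matrices. -/
def IsCompactEuclidean (H : Subgroup (GL n ℂ)) : Prop :=
  IsCompact ((fun M : GL n ℂ => (M : Matrix n n ℂ)) '' (H : Set (GL n ℂ)))

/-- The group of rational matrices `H`, regarded as a group of matrices over a field `k` of
characteristic zero. -/
def rationalPoints (k : Type*) [Field k] [CharZero k] (H : Subgroup (GL n ℚ)) :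
    Subgroup (GL n k) :=
  H.map (Matrix.GeneralLinearGroup.map (Rat.castHom k))

end Density

end ClassicalDensity

/-! Density of `H` in `G` follows once every polynomial in the entries that vanishes on `H` vanishes
on `G`, that is, once `G` lies in `zariskiHull H`. This hull is closed under products, so it
suffices to place generators of `G` in it.

For (b), generators of G(k) come in families whose entries are rational functions of free
parameters, with rational parameters giving elements of G(ℚ). A polynomial vanishing on all rational
parameters is zero, so each family lies in the hull (`mem_hull_rationalPoints_of_parametrization`).
GL and SL are each a single family. Reflections generate O (`mem_of_reflectionUnit_mem`); symmetric
shears and Levi blocks generate Sp (`mem_of_shears_mem`).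

For (a), compactness holds because unitary entries are bounded. For density, write g*g = E(1) with
E(z) = V diag(exp(zμ)) V*, μ real. Then F(z) = g E(z) is entire with F(0) = g, and F(z) is unitary
for Re z = -1/2. If all E(z) lie in G, a polynomial vanishing on the unitary part of G vanishes
along that line, hence at every F(z) by the identity theorem, and so at g. -/

namespace ClassicalDensity

/-! ### Zariski closure of a subgroup and the density criterion -/

section Hull

variable {n : Type*} [Fintype n] [DecidableEq n] {K : Type*} [Field K]

/-- The entries of a matrix, as a point of affine space. -/
def entries (M : Matrix n n K) : n × n → K := fun p => M p.1 p.2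

/-- The Zariski closure of `H` in `GL_n(K)`, as a submonoid. -/
def zariskiHull (H : Subgroup (GL n K)) : Submonoid (GL n K) where
  carrier := {g | ∀ p : MvPolynomial (n × n) K,
    (∀ h ∈ H, MvPolynomial.eval (entries (h : Matrix n n K)) p = 0) →
      MvPolynomial.eval (entries (g : Matrix n n K)) p = 0}
  one_mem' := fun p hp => hp 1 H.one_mem
  mul_mem' := by
    intro a b ha hb p hp
    have left : ∀ c : GL n K, ∃ q : MvPolynomial (n × n) K, ∀ x : GL n K,
        MvPolynomial.eval (entries (x : Matrix n n K)) q =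
          MvPolynomial.eval (entries ((c * x : GL n K) : Matrix n n K)) p := by
      intro c
      refine ⟨MvPolynomial.bind₁ (fun s : n × n => ∑ l, MvPolynomial.C ((c : Matrix n n K) s.1 l) *
        MvPolynomial.X (l, s.2)) p, fun x => ?_⟩
      rw [← MvPolynomial.coe_aeval_eq_eval, ← MvPolynomial.coe_aeval_eq_eval]
      simp only [RingHom.coe_coe, MvPolynomial.aeval_bind₁]
      congr 2
      ext s
      simp [entries, Matrix.mul_apply]
    have right : ∀ c : GL n K, ∃ q : MvPolynomial (n × n) K, ∀ x : GL n K,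
        MvPolynomial.eval (entries (x : Matrix n n K)) q =
          MvPolynomial.eval (entries ((x * c : GL n K) : Matrix n n K)) p := by
      intro c
      refine ⟨MvPolynomial.bind₁ (fun s : n × n => ∑ l, MvPolynomial.X (s.1, l) *
        MvPolynomial.C ((c : Matrix n n K) l s.2)) p, fun x => ?_⟩
      rw [← MvPolynomial.coe_aeval_eq_eval, ← MvPolynomial.coe_aeval_eq_eval]
      simp only [RingHom.coe_coe, MvPolynomial.aeval_bind₁]
      congr 2
      ext s
      simp [entries, Matrix.mul_apply]
    -- Two translations: for h in `H`, x ↦ p(hx) vanishes on `H`, hence at b. So x ↦ p(xb) vanishes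
    -- on `H`, hence at a.
    obtain ⟨q, hq⟩ := right b
    rw [← hq]
    refine ha q fun h hh => ?_
    obtain ⟨r, hr⟩ := left h
    rw [hq, ← hr]
    refine hb r fun h' hh' => ?_
    rw [hr]
    exact hp _ (H.mul_mem hh hh')

theorem isZariskiDenseSubgroup_of_le_hull {H G : Subgroup (GL n K)} (hHG : H ≤ G)
    (h : ∀ g ∈ G, g ∈ zariskiHull H) : IsZariskiDenseSubgroup H G := by
  let _ : TopologicalSpace G := groupZariskiTopology G
  refine ⟨hHG, fun g => mem_closure_iff.2 ?_⟩
  rintro _ ⟨O, hO, rfl⟩ hg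
  obtain ⟨I, hI⟩ : ∃ I : Ideal (MvPolynomial (n × n) K), Oᶜ = MvPolynomial.zeroLocus K I := hO
  have hg' : entries ((g : GL n K) : Matrix n n K) ∉ MvPolynomial.zeroLocus K I := by
    rw [← hI]
    exact fun hn => hn hg
  simp only [MvPolynomial.mem_zeroLocus_iff, not_forall] at hg'
  obtain ⟨p, hp, hpg⟩ := hg'
  have : ¬ ∀ h ∈ H, MvPolynomial.eval (entries (h : Matrix n n K)) p = 0 := fun hn =>
    hpg (h g g.2 p hn)
  push Not at this
  obtain ⟨x, hx, hxp⟩ := this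
  refine ⟨⟨x, hHG hx⟩, ?_, hx⟩
  by_contra hn
  have hn' : entries (x : Matrix n n K) ∈ Oᶜ := hn
  rw [hI] at hn'
  exact hxp (hn' p hp)

end Hull

/-! ### Rational families and density of rational parameters -/

section RationalParametrization

variable {k : Type*} [Field k]

/-- Clearing denominators. The exponent and the numerator do not depend on the point, so vanishing
on the family becomes vanishing of one polynomial. -/
theorem exists_eval_div_mul_pow {σ τ : Type*} (d : MvPolynomial τ k) (M : σ → MvPolynomial τ k)
    (p : MvPolynomial σ k) : ∃ (N : ℕ) (Q : MvPolynomial τ k), ∀ x, MvPolynomial.eval x d ≠ 0 →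
      MvPolynomial.eval (fun s => MvPolynomial.eval x (M s) / MvPolynomial.eval x d) p *
        MvPolynomial.eval x d ^ N = MvPolynomial.eval x Q := by
  induction p using MvPolynomial.induction_on with
  | C a => exact ⟨0, MvPolynomial.C a, fun x _ => by simp⟩
  | add p q hp hq =>
    obtain ⟨N, P, hP⟩ := hp
    obtain ⟨N', Q, hQ⟩ := hq
    refine ⟨N + N', P * d ^ N' + Q * d ^ N, fun x hx => ?_⟩
    simp only [map_add, map_mul, map_pow, ← hP x hx, ← hQ x hx]
    ring
  | mul_X p s hp =>
    obtain ⟨N, P, hP⟩ := hp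
    refine ⟨N + 1, P * M s, fun x hx => ?_⟩
    simp only [map_mul, MvPolynomial.eval_X, ← hP x hx]
    field_simp
    ring

theorem eval_div_eq_zero_of_rational [CharZero k] {σ τ : Type*} (d : MvPolynomial τ k)
    (M : σ → MvPolynomial τ k) (p : MvPolynomial σ k)
    (h : ∀ x : τ → ℚ, MvPolynomial.eval (fun i => (x i : k)) d ≠ 0 →
      MvPolynomial.eval (fun s => MvPolynomial.eval (fun i => (x i : k)) (M s) /
        MvPolynomial.eval (fun i => (x i : k)) d) p = 0)
    (x : τ → k) (hx : MvPolynomial.eval x d ≠ 0) :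
    MvPolynomial.eval (fun s => MvPolynomial.eval x (M s) / MvPolynomial.eval x d) p = 0 := by
  obtain ⟨N, Q, hQ⟩ := exists_eval_div_mul_pow d M p
  -- The factor d covers the rational points where d vanishes, about which nothing is known. ℚ is
  -- infinite in k, so vanishing on rational points forces the zero polynomial.
  have hz : Q * d = 0 := by
    refine MvPolynomial.funext_set (fun _ => Set.range ((↑) : ℚ → k))
      (fun _ => Set.infinite_range_of_injective Rat.cast_injective) fun y hy => ?_
    choose z hz using fun i => hy i (Set.mem_univ i)
    obtain rfl : (fun i => (z i : k)) = y := funext hz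
    by_cases hd : MvPolynomial.eval (fun i => (z i : k)) d = 0
    · simp [hd]
    · rw [map_mul, ← hQ _ hd, h z hd]
      simp
  have := congrArg (MvPolynomial.eval x) hz
  rw [map_mul, ← hQ x hx, map_zero] at this
  simpa [hx] using this

variable [CharZero k] {n : Type*} [Fintype n] [DecidableEq n]

/-- A point of a rational family of matrices whose rational members come from `H(ℚ)` lies in the
Zariski closure of `H(ℚ)`. -/
theorem mem_hull_rationalPoints_of_parametrization {H : Subgroup (GL n ℚ)} {τ : Type*}
    (d : MvPolynomial τ k) (M : n → n → MvPolynomial τ k)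
    (h : ∀ x : τ → ℚ, MvPolynomial.eval (fun i => (x i : k)) d ≠ 0 → ∃ g ∈ H, ∀ i j,
      (((g : Matrix n n ℚ) i j : ℚ) : k) = MvPolynomial.eval (fun i => (x i : k)) (M i j) /
        MvPolynomial.eval (fun i => (x i : k)) d)
    (g : GL n k) (x : τ → k) (hx : MvPolynomial.eval x d ≠ 0)
    (hg : ∀ i j, (g : Matrix n n k) i j = MvPolynomial.eval x (M i j) / MvPolynomial.eval x d) :
    g ∈ zariskiHull (rationalPoints k H) := by
  intro p hp
  have hg' : entries (g : Matrix n n k) =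
      fun s => MvPolynomial.eval x (M s.1 s.2) / MvPolynomial.eval x d := by
    ext s
    exact hg s.1 s.2
  rw [hg']
  apply eval_div_eq_zero_of_rational d (fun s : n × n => M s.1 s.2) p _ x hx
  intro y hy
  obtain ⟨u, hu, huM⟩ := h y hy
  have key := hp (Matrix.GeneralLinearGroup.map (Rat.castHom k) u) ⟨u, hu, rfl⟩
  have e : entries ((Matrix.GeneralLinearGroup.map (Rat.castHom k) u : GL n k) : Matrix n n k) =
      fun s => MvPolynomial.eval (fun i => (y i : k)) (M s.1 s.2) /
        MvPolynomial.eval (fun i => (y i : k)) d := by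
    ext s
    rw [← huM s.1 s.2]
    simp [entries]
  rw [e] at key
  exact key

end RationalParametrization

/-! ### Base change from ℚ to k preserves each group -/

section RationalPoints

variable {k : Type*} [Field k] [CharZero k] {n : Type*} [Fintype n] [DecidableEq n]

theorem rationalPoints_generalLinear_le :
    rationalPoints k (generalLinear n ℚ) ≤ generalLinear n k := fun _ _ => Subgroup.mem_top _

theorem rationalPoints_specialLinear_le :
    rationalPoints k (specialLinear n ℚ) ≤ specialLinear n k := by
  rintro _ ⟨g, hg, rfl⟩
  have hg' : (g : Matrix n n ℚ).det = 1 := hg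
  change (((Rat.castHom k).mapMatrix (g : Matrix n n ℚ))).det = 1
  rw [← RingHom.map_det, hg', map_one]

theorem rationalPoints_formStabilizer_le (B : Matrix n n ℚ) :
    rationalPoints k (formStabilizer B) ≤ formStabilizer ((Rat.castHom k).mapMatrix B) := by
  rintro _ ⟨g, hg, rfl⟩
  have hg' : (g : Matrix n n ℚ)ᵀ * B * (g : Matrix n n ℚ) = B := hg
  change ((Rat.castHom k).mapMatrix (g : Matrix n n ℚ))ᵀ * (Rat.castHom k).mapMatrix B *
    (Rat.castHom k).mapMatrix (g : Matrix n n ℚ) = (Rat.castHom k).mapMatrix B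
  conv_rhs => rw [← hg']
  rw [map_mul, map_mul]
  congr 2

theorem rationalPoints_orthogonal_le :
    rationalPoints k (orthogonal n ℚ) ≤ orthogonal n k := by
  have := rationalPoints_formStabilizer_le (k := k) (1 : Matrix n n ℚ)
  rwa [map_one] at this

theorem rationalPoints_symplectic_le :
    rationalPoints k (symplectic n ℚ) ≤ symplectic n k := by
  have := rationalPoints_formStabilizer_le (k := k)
    (Matrix.fromBlocks 0 1 (-1) 0 : Matrix (n ⊕ n) (n ⊕ n) ℚ)
  have e : (Rat.castHom k).mapMatrix (Matrix.fromBlocks 0 1 (-1) 0 : Matrix (n ⊕ n) (n ⊕ n) ℚ) =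
      Matrix.fromBlocks 0 1 (-1) 0 := by
    rw [RingHom.mapMatrix_apply, Matrix.fromBlocks_map]
    congr 1 <;> ext i j <;> simp [Matrix.one_apply, apply_ite]
  rwa [e] at this

end RationalPoints

/-! ### Rational density for GL and SL -/

section LinearGroups

variable {k : Type*} [Field k] {n : Type*} [Fintype n] [DecidableEq n]

theorem eval_mvPolynomialX_det (x : n × n → k) :
    MvPolynomial.eval x (Matrix.mvPolynomialX n n k).det = (Matrix.of fun i j => x (i, j)).det := by
  rw [RingHom.map_det]
  congr 1
  ext i j
  simp

theorem eval_mvPolynomialX_adjugate (x : n × n → k) (i j : n) :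
    MvPolynomial.eval x ((Matrix.mvPolynomialX n n k).adjugate i j) =
      (Matrix.of fun i j => x (i, j)).adjugate i j := by
  have h := RingHom.map_adjugate (MvPolynomial.eval x) (Matrix.mvPolynomialX n n k)
  have e : (MvPolynomial.eval x).mapMatrix (Matrix.mvPolynomialX n n k) =
      Matrix.of fun i j => x (i, j) := by
    ext i j
    simp
  rw [e] at h
  rw [← h]
  simp

variable [CharZero k]

theorem det_of_cast (x : n × n → ℚ) :
    (Matrix.of fun i j => (x (i, j) : k)).det = (((Matrix.of fun i j => x (i, j)).det : ℚ) : k) := by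
  rw [← Rat.coe_castHom, RingHom.map_det]
  rfl

theorem isZariskiDenseSubgroup_generalLinear_rational :
    IsZariskiDenseSubgroup (rationalPoints k (generalLinear n ℚ)) (generalLinear n k) := by
  refine isZariskiDenseSubgroup_of_le_hull rationalPoints_generalLinear_le fun g _ => ?_
  have hdet : (Matrix.of fun i j => entries (g : Matrix n n k) (i, j)).det ≠ 0 :=
    ((Matrix.isUnit_iff_isUnit_det _).1 g.isUnit).ne_zero
  -- The family is the generic matrix, written (det · X) / det so that the denominator excludes
  -- singular parameters.
  refine mem_hull_rationalPoints_of_parametrization (mvPolynomialX n n k).det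
    (fun i j => (mvPolynomialX n n k).det * MvPolynomial.X (i, j)) (fun x hx => ?_) g
    (entries (g : Matrix n n k)) ?_ fun i j => ?_
  · rw [eval_mvPolynomialX_det, det_of_cast] at hx
    refine ⟨GeneralLinearGroup.mkOfDetNeZero (Matrix.of fun i j => x (i, j))
      (by exact_mod_cast hx), Subgroup.mem_top _, fun i j => ?_⟩
    rw [map_mul, mul_div_cancel_left₀ _ (by rwa [eval_mvPolynomialX_det, det_of_cast])]
    simp [GeneralLinearGroup.mkOfDetNeZero]
  · rwa [eval_mvPolynomialX_det]
  · rw [map_mul, mul_div_cancel_left₀ _ (by rwa [eval_mvPolynomialX_det])]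
    simp [entries]

theorem isZariskiDenseSubgroup_specialLinear_rational [Nonempty n] :
    IsZariskiDenseSubgroup (rationalPoints k (specialLinear n ℚ)) (specialLinear n k) := by
  obtain ⟨a⟩ := ‹Nonempty n›
  refine isZariskiDenseSubgroup_of_le_hull rationalPoints_specialLinear_le fun g hg => ?_
  have hdet : (Matrix.of fun i j => entries (g : Matrix n n k) (i, j)).det = 1 := hg
  -- Dividing row a of a generic matrix by its determinant gives determinant 1, and leaves matrices
  -- already in SL unchanged.
  refine mem_hull_rationalPoints_of_parametrization (mvPolynomialX n n k).det
    (fun i j => if i = a then MvPolynomial.X (i, j) else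
      (mvPolynomialX n n k).det * MvPolynomial.X (i, j)) (fun x hx => ?_) g
    (entries (g : Matrix n n k)) ?_ fun i j => ?_
  · rw [eval_mvPolynomialX_det, det_of_cast] at hx
    set Y : Matrix n n ℚ := Matrix.of fun i j => x (i, j) with hY
    have hY0 : Y.det ≠ 0 := by exact_mod_cast hx
    have h1 : (Y.updateRow a (Y.det⁻¹ • Y a)).det = 1 := by
      rw [det_updateRow_smul, updateRow_eq_self, inv_mul_cancel₀ hY0]
    refine ⟨GeneralLinearGroup.mkOfDetNeZero (Y.updateRow a (Y.det⁻¹ • Y a))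
      (by rw [h1]; exact one_ne_zero), h1, fun i j => ?_⟩
    change ((Y.updateRow a (Y.det⁻¹ • Y a) i j : ℚ) : k) = _
    rw [eval_mvPolynomialX_det, det_of_cast, ← hY]
    by_cases hi : i = a
    · subst hi
      simp [hY, div_eq_inv_mul]
    · rw [updateRow_ne hi, if_neg hi, map_mul, eval_mvPolynomialX_det, det_of_cast, ← hY,
        mul_div_cancel_left₀ _ hx]
      simp [hY]
  · rw [eval_mvPolynomialX_det, hdet]
    exact one_ne_zero
  · rw [eval_mvPolynomialX_det, hdet]
    by_cases hi : i = a
    · simp [hi, entries]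
    · rw [if_neg hi, map_mul, eval_mvPolynomialX_det, hdet]
      simp [entries]

end LinearGroups

/-! ### Making a block invertible by a symmetric shear -/

section SymmetricPerturbation

variable {K : Type*} [Field K] {n : Type*} [Fintype n] [DecidableEq n]

/-- If `(X, Y)` spans a Lagrangian subspace, then some symmetric `S` makes `X + S Y` invertible. -/
theorem exists_isSymm_isUnit_add_mul (X Y : Matrix n n K) (hsymm : (Xᵀ * Y).IsSymm)
    (hker : ∀ v, X *ᵥ v = 0 → Y *ᵥ v = 0 → v = 0) :
    ∃ S : Matrix n n K, S.IsSymm ∧ IsUnit (X + S * Y) := by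
  induction hd : Module.finrank K (LinearMap.ker X.mulVecLin) using Nat.strong_induction_on
    generalizing X with
  | _ d ih =>
  by_cases hX : IsUnit X
  · exact ⟨0, Matrix.isSymm_zero, by simpa using hX⟩
  obtain ⟨w, hw0, hw⟩ : ∃ w, w ≠ 0 ∧ X *ᵥ w = 0 := by
    rw [Matrix.exists_mulVec_eq_zero_iff]
    by_contra h
    exact hX ((Matrix.isUnit_iff_isUnit_det _).2 (isUnit_iff_ne_zero.2 h))
  set y := Y *ᵥ w with hy
  have hy0 : y ≠ 0 := fun h => hw0 (hker w hw h)
  -- Symmetry of XᵀY turns Xw = 0 into Xᵀ(Yw) = 0.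
  have hyX : y ᵥ* X = 0 := by
    have h1 : (Xᵀ * Y) *ᵥ w = 0 := by
      rw [← hsymm, Matrix.transpose_mul, Matrix.transpose_transpose, ← Matrix.mulVec_mulVec, hw,
        Matrix.mulVec_zero]
    rwa [← Matrix.mulVec_mulVec, Matrix.mulVec_transpose] at h1
  obtain ⟨i, hi⟩ : ∃ i, y i ≠ 0 := Function.ne_iff.1 hy0
  set S₀ : Matrix n n K := Matrix.single i i 1 with hS₀
  have hS₀s : S₀.IsSymm := by simp [hS₀, Matrix.IsSymm]
  have hS₀v : ∀ z, S₀ *ᵥ z = Pi.single i (z i) := by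
    intro z
    rw [hS₀, Matrix.single_mulVec]
    ext j
    simp [Function.update_apply, Pi.single_apply]
  -- Pairing with y kills Xu and leaves y i · (Yu) i = 0, so S₀Yu = 0 and then Xu = 0. The kernel
  -- thus shrinks, strictly since w leaves it.
  have hsub : ∀ u, (X + S₀ * Y) *ᵥ u = 0 → X *ᵥ u = 0 := by
    intro u hu
    have hu' : X *ᵥ u + S₀ *ᵥ (Y *ᵥ u) = 0 := by
      rwa [Matrix.mulVec_mulVec, ← Matrix.add_mulVec]
    have h2 : y ⬝ᵥ (X *ᵥ u + S₀ *ᵥ (Y *ᵥ u)) = 0 := by rw [hu', dotProduct_zero]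
    rw [dotProduct_add, Matrix.dotProduct_mulVec, hyX, zero_dotProduct, zero_add, hS₀v,
      dotProduct_single] at h2
    have h4 : (Y *ᵥ u) i = 0 := (mul_eq_zero.1 h2).resolve_left hi
    rwa [hS₀v, h4, Pi.single_zero, add_zero] at hu'
  have hlt : LinearMap.ker (X + S₀ * Y).mulVecLin < LinearMap.ker X.mulVecLin := by
    refine lt_of_le_of_ne (fun u hu => hsub u hu) fun heq => ?_
    have hw' : w ∈ LinearMap.ker (X + S₀ * Y).mulVecLin := heq ▸ hw
    have h5 : (X + S₀ * Y) *ᵥ w = 0 := hw'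
    rw [Matrix.add_mulVec, hw, zero_add, ← Matrix.mulVec_mulVec, ← hy, hS₀v] at h5
    have := congrFun h5 i
    exact hi (by simpa using this)
  obtain ⟨S, hS, hunit⟩ := ih _ (hd ▸ Submodule.finrank_lt_finrank_of_lt hlt) (X + S₀ * Y)
    (by
      have : (Yᵀ * S₀ * Y).IsSymm := by
        simp only [Matrix.IsSymm, Matrix.transpose_mul, Matrix.transpose_transpose, hS₀s.eq,
          Matrix.mul_assoc]
      rw [Matrix.transpose_add, Matrix.transpose_mul, hS₀s.eq, Matrix.add_mul]
      exact hsymm.add this)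
    (fun v hv hv' => hker v (hsub v hv) hv') rfl
  refine ⟨S₀ + S, hS₀s.add hS, ?_⟩
  rwa [Matrix.add_mul, ← add_assoc]

end SymmetricPerturbation

/-! ### Reflections and rational density for O -/

section Reflections

variable {k : Type*} [Field k] {n : Type*} [Fintype n] [DecidableEq n]

/-- The reflection in the hyperplane orthogonal to `v`. -/
def reflectionMatrix (v : n → k) : Matrix n n k := 1 - (2 / (v ⬝ᵥ v)) • vecMulVec v v

theorem reflectionMatrix_mulVec (v u : n → k) :
    reflectionMatrix v *ᵥ u = u - (2 / (v ⬝ᵥ v) * (v ⬝ᵥ u)) • v := by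
  rw [reflectionMatrix, sub_mulVec, one_mulVec, smul_mulVec, vecMulVec_mulVec]
  ext i
  simp [mul_assoc, mul_comm]

theorem reflectionMatrix_mulVec_eq_self {v u : n → k} (h : v ⬝ᵥ u = 0) :
    reflectionMatrix v *ᵥ u = u := by
  rw [reflectionMatrix_mulVec, h, mul_zero, zero_smul, sub_zero]

theorem reflectionMatrix_transpose (v : n → k) : (reflectionMatrix v)ᵀ = reflectionMatrix v := by
  ext i j
  simp [reflectionMatrix, vecMulVec_apply, one_apply, eq_comm, mul_comm]

theorem reflectionMatrix_mul_self {v : n → k} (hv : v ⬝ᵥ v ≠ 0) :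
    reflectionMatrix v * reflectionMatrix v = 1 := by
  refine ext_of_mulVec_single fun i => ?_
  rw [← mulVec_mulVec, reflectionMatrix_mulVec, reflectionMatrix_mulVec, one_mulVec]
  set e : n → k := Pi.single i 1
  rw [dotProduct_sub, dotProduct_smul]
  ext j
  simp only [Pi.sub_apply, Pi.smul_apply, smul_eq_mul]
  field_simp
  ring

/-- The reflection orthogonal to an anisotropic vector, as an invertible matrix. -/
def reflectionUnit (v : n → k) (hv : v ⬝ᵥ v ≠ 0) : GL n k :=
  ⟨reflectionMatrix v, reflectionMatrix v, reflectionMatrix_mul_self hv,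
    reflectionMatrix_mul_self hv⟩

theorem reflectionUnit_mem_orthogonal (v : n → k) (hv : v ⬝ᵥ v ≠ 0) :
    reflectionUnit v hv ∈ orthogonal n k := by
  change (reflectionMatrix v)ᵀ * 1 * reflectionMatrix v = 1
  rw [reflectionMatrix_transpose, mul_one, reflectionMatrix_mul_self hv]

theorem reflectionUnit_mul_self (v : n → k) (hv : v ⬝ᵥ v ≠ 0) :
    reflectionUnit v hv * reflectionUnit v hv = 1 :=
  Units.ext (reflectionMatrix_mul_self hv)

theorem dotProduct_mulVec_of_mem_orthogonal {g : GL n k} (hg : g ∈ orthogonal n k) (u v : n → k) :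
    ((g : Matrix n n k) *ᵥ u) ⬝ᵥ ((g : Matrix n n k) *ᵥ v) = u ⬝ᵥ v := by
  have hg' : (g : Matrix n n k)ᵀ * 1 * (g : Matrix n n k) = 1 := hg
  rw [dotProduct_mulVec, ← mulVec_transpose, mulVec_mulVec]
  rw [mul_one] at hg'
  rw [hg', one_mulVec]

/-- In characteristic different from two, every orthogonal matrix is a product of reflections. -/
theorem mem_of_reflectionUnit_mem (h2 : (2 : k) ≠ 0) (S : Submonoid (GL n k))
    (hS : ∀ v hv, reflectionUnit v hv ∈ S) {g : GL n k} (hg : g ∈ orthogonal n k) : g ∈ S := by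
  -- Cartan–Dieudonné by induction on a set s containing every index whose standard basis vector g
  -- may move.
  suffices H : ∀ (s : Finset n) (g : GL n k), g ∈ orthogonal n k →
      (∀ i ∉ s, (g : Matrix n n k) *ᵥ Pi.single i 1 = Pi.single i 1) → g ∈ S from
    H Finset.univ g hg fun i hi => absurd (Finset.mem_univ i) hi
  intro s
  induction s using Finset.induction_on with
  | empty =>
    intro g _ h
    have : g = 1 := Units.ext (ext_of_mulVec_single fun i => by
      rw [h i (Finset.notMem_empty i), Units.val_one, one_mulVec])
    exact this ▸ S.one_mem
  | insert a s ha ih =>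
    intro g hg h
    set e : n → k := Pi.single a 1 with he
    set u := (g : Matrix n n k) *ᵥ e with hu
    have hee : e ⬝ᵥ e = 1 := by simp [he]
    have huu : u ⬝ᵥ u = 1 := by rw [hu, dotProduct_mulVec_of_mem_orthogonal hg, hee]
    have hfix : ∀ i ∉ insert a s, u ⬝ᵥ Pi.single i 1 = 0 ∧ e ⬝ᵥ (Pi.single i 1 : n → k) = 0 := by
      intro i hi
      have hia : i ≠ a := fun h' => hi (h' ▸ Finset.mem_insert_self a s)
      have h0 : e ⬝ᵥ (Pi.single i 1 : n → k) = 0 := by simp [he, hia]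
      refine ⟨?_, h0⟩
      conv_lhs => rw [← h i hi]
      rw [hu, dotProduct_mulVec_of_mem_orthogonal hg, h0]
    -- The reflection in u - e would send u to e. If u - e is isotropic, the parallelogram identity
    -- gives u + e norm 4 ≠ 0; reflecting in u + e sends u to -e, and reflecting in e then gives e.
    -- Basis vectors already fixed are orthogonal to u and e, so they stay fixed.
    by_cases hv : (u - e) ⬝ᵥ (u - e) = 0
    · have hv' : (u + e) ⬝ᵥ (u + e) ≠ 0 := by
        have : (u + e) ⬝ᵥ (u + e) + (u - e) ⬝ᵥ (u - e) = 2 * 2 := by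
          simp only [add_dotProduct, dotProduct_add, sub_dotProduct, dotProduct_sub, huu, hee]
          ring
        rw [hv, add_zero] at this
        rw [this]
        exact mul_ne_zero h2 h2
      have hee' : e ⬝ᵥ e ≠ 0 := by rw [hee]; exact one_ne_zero
      have hmem := ih (reflectionUnit e hee' * (reflectionUnit (u + e) hv' * g))
        (Subgroup.mul_mem _ (reflectionUnit_mem_orthogonal _ _)
          (Subgroup.mul_mem _ (reflectionUnit_mem_orthogonal _ _) hg)) fun i hi => ?_
      · have : g = reflectionUnit (u + e) hv' * (reflectionUnit e hee' *
            (reflectionUnit e hee' * (reflectionUnit (u + e) hv' * g))) := by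
          rw [← mul_assoc (reflectionUnit e hee'), reflectionUnit_mul_self, one_mul, ← mul_assoc,
            reflectionUnit_mul_self, one_mul]
        rw [this]
        exact S.mul_mem (hS _ _) (S.mul_mem (hS _ _) hmem)
      · change (reflectionMatrix e * (reflectionMatrix (u + e) * (g : Matrix n n k))) *ᵥ _ = _
        rw [← mulVec_mulVec, ← mulVec_mulVec]
        by_cases hia : i = a
        · subst hia
          have h1 : reflectionMatrix (u + e) *ᵥ u = -e := by
            have hc : 2 / ((u + e) ⬝ᵥ (u + e)) * ((u + e) ⬝ᵥ u) = 1 := by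
              have : (u + e) ⬝ᵥ (u + e) = 2 * ((u + e) ⬝ᵥ u) := by
                simp only [add_dotProduct, dotProduct_add, huu, hee, dotProduct_comm e u]
                ring
              rw [div_mul_eq_mul_div, ← this, div_self hv']
            rw [reflectionMatrix_mulVec, hc, one_smul, sub_add_cancel_left]
          rw [← he, ← hu, h1, mulVec_neg, reflectionMatrix_mulVec, hee]
          ext j
          simp
          ring
        · have hi' : i ∉ insert a s := by simp [hia, hi]
          obtain ⟨h3, h4⟩ := hfix i hi'
          rw [h i hi', reflectionMatrix_mulVec_eq_self (v := u + e)
            (by rw [add_dotProduct, h3, h4, add_zero]),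
            reflectionMatrix_mulVec_eq_self h4]
    · have hmem := ih (reflectionUnit (u - e) hv * g)
        (Subgroup.mul_mem _ (reflectionUnit_mem_orthogonal _ _) hg) fun i hi => ?_
      · have : g = reflectionUnit (u - e) hv * (reflectionUnit (u - e) hv * g) := by
          rw [← mul_assoc, reflectionUnit_mul_self, one_mul]
        rw [this]
        exact S.mul_mem (hS _ _) hmem
      · change (reflectionMatrix (u - e) * (g : Matrix n n k)) *ᵥ _ = _
        rw [← mulVec_mulVec]
        by_cases hia : i = a
        · subst hia
          have hc : 2 / ((u - e) ⬝ᵥ (u - e)) * ((u - e) ⬝ᵥ u) = 1 := by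
            have : (u - e) ⬝ᵥ (u - e) = 2 * ((u - e) ⬝ᵥ u) := by
              simp only [sub_dotProduct, dotProduct_sub, huu, hee, dotProduct_comm e u]
              ring
            rw [div_mul_eq_mul_div, ← this, div_self hv]
          rw [← he, ← hu, reflectionMatrix_mulVec, hc, one_smul, sub_sub_cancel]
        · have hi' : i ∉ insert a s := by simp [hia, hi]
          obtain ⟨h3, h4⟩ := hfix i hi'
          rw [h i hi', reflectionMatrix_mulVec_eq_self (by rw [sub_dotProduct, h3, h4, sub_zero])]

theorem isZariskiDenseSubgroup_orthogonal_rational [CharZero k] :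
    IsZariskiDenseSubgroup (rationalPoints k (orthogonal n ℚ)) (orthogonal n k) := by
  refine isZariskiDenseSubgroup_of_le_hull rationalPoints_orthogonal_le fun g hg =>
    mem_of_reflectionUnit_mem two_ne_zero _ (fun v hv => ?_) hg
  have hd : ∀ x : n → k, MvPolynomial.eval x
      (∑ i, MvPolynomial.X i * MvPolynomial.X i : MvPolynomial n k) = x ⬝ᵥ x := by
    intro x
    simp [dotProduct]
  have hM : ∀ x : n → k, x ⬝ᵥ x ≠ 0 → ∀ i j, reflectionMatrix x i j = MvPolynomial.eval x
      ((∑ i, MvPolynomial.X i * MvPolynomial.X i : MvPolynomial n k) * MvPolynomial.C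
        ((1 : Matrix n n k) i j) - 2 * MvPolynomial.X i * MvPolynomial.X j) / (x ⬝ᵥ x) := by
    intro x hx i j
    rw [map_sub, map_mul, hd]
    simp [reflectionMatrix, vecMulVec_apply]
    field_simp
  refine mem_hull_rationalPoints_of_parametrization _
    (fun i j => (∑ i, MvPolynomial.X i * MvPolynomial.X i : MvPolynomial n k) * MvPolynomial.C
        ((1 : Matrix n n k) i j) - 2 * MvPolynomial.X i * MvPolynomial.X j) (fun x hx => ?_) _ v
    (by rw [hd]; exact hv) fun i j => ?_
  · rw [hd] at hx ⊢
    have hxx : (fun i => (x i : k)) ⬝ᵥ (fun i => (x i : k)) = ((x ⬝ᵥ x : ℚ) : k) := by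
      simp [dotProduct]
    have hx' : x ⬝ᵥ x ≠ 0 := by
      rw [hxx] at hx
      exact_mod_cast hx
    refine ⟨reflectionUnit x hx', reflectionUnit_mem_orthogonal _ _, fun i j => ?_⟩
    rw [← hM _ hx]
    change ((reflectionMatrix x i j : ℚ) : k) = _
    simp only [reflectionMatrix, hxx, vecMulVec_apply, Matrix.sub_apply,
      Matrix.smul_apply, one_apply, smul_eq_mul]
    split_ifs <;> push_cast <;> rfl
  · rw [hd, ← hM v hv]
    rfl

end Reflections

/-! ### Block generators and rational density for Sp -/

section Symplectic

variable {k : Type*} [Field k] {n : Type*} [Fintype n] [DecidableEq n]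

/-- The lower left block of the form equation is minus the transpose of the upper right one, so
three conditions remain. -/
theorem mem_symplectic_iff {g : GL (n ⊕ n) k} {A B C D : Matrix n n k}
    (h : (g : Matrix (n ⊕ n) (n ⊕ n) k) = fromBlocks A B C D) :
    g ∈ symplectic n k ↔ Aᵀ * C = Cᵀ * A ∧ Aᵀ * D - Cᵀ * B = 1 ∧ Bᵀ * D = Dᵀ * B := by
  change (g : Matrix (n ⊕ n) (n ⊕ n) k)ᵀ * fromBlocks 0 1 (-1) 0 *
    (g : Matrix (n ⊕ n) (n ⊕ n) k) = fromBlocks 0 1 (-1) 0 ↔ _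
  rw [h, fromBlocks_transpose, fromBlocks_multiply, fromBlocks_multiply, fromBlocks_inj]
  simp only [mul_zero, mul_one, mul_neg, zero_add, add_zero, neg_mul]
  constructor
  · rintro ⟨h1, h2, -, h4⟩
    refine ⟨?_, ?_, ?_⟩
    · rwa [neg_add_eq_sub, sub_eq_zero] at h1
    · rwa [neg_add_eq_sub] at h2
    · rwa [neg_add_eq_sub, sub_eq_zero] at h4
  · rintro ⟨h1, h2, h4⟩
    refine ⟨?_, ?_, ?_, ?_⟩
    · rw [h1, neg_add_cancel]
    · rw [neg_add_eq_sub, h2]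
    · have := congrArg transpose h2
      simp only [transpose_sub, transpose_mul, transpose_transpose, transpose_one] at this
      rw [neg_add_eq_sub, ← this, neg_sub]
    · rw [h4, neg_add_cancel]

/-- The symplectic matrix `[[1, S], [0, 1]]`. -/
def upperShear (S : Matrix n n k) : GL (n ⊕ n) k :=
  ⟨fromBlocks 1 S 0 1, fromBlocks 1 (-S) 0 1, by simp [fromBlocks_multiply],
    by simp [fromBlocks_multiply]⟩

/-- The symplectic matrix `[[1, 0], [S, 1]]`. -/
def lowerShear (S : Matrix n n k) : GL (n ⊕ n) k :=
  ⟨fromBlocks 1 0 S 1, fromBlocks 1 0 (-S) 1, by simp [fromBlocks_multiply],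
    by simp [fromBlocks_multiply]⟩

/-- The symplectic matrix `[[A, 0], [0, A⁻ᵀ]]`. -/
def leviBlock (A : GL n k) : GL (n ⊕ n) k :=
  ⟨fromBlocks (A : Matrix n n k) 0 0 ((A⁻¹ : GL n k) : Matrix n n k)ᵀ,
    fromBlocks ((A⁻¹ : GL n k) : Matrix n n k) 0 0 (A : Matrix n n k)ᵀ,
    by simp [fromBlocks_multiply, ← transpose_mul, -coe_units_inv],
    by simp [fromBlocks_multiply, ← transpose_mul, -coe_units_inv]⟩

theorem upperShear_mem_symplectic {S : Matrix n n k} (hS : S.IsSymm) :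
    upperShear S ∈ symplectic n k := by
  rw [mem_symplectic_iff (A := 1) (B := S) (C := 0) (D := 1) rfl]
  simp [hS.eq]

theorem lowerShear_mem_symplectic {S : Matrix n n k} (hS : S.IsSymm) :
    lowerShear S ∈ symplectic n k := by
  rw [mem_symplectic_iff (A := 1) (B := 0) (C := S) (D := 1) rfl]
  simp [hS.eq]

theorem leviBlock_mem_symplectic (A : GL n k) : leviBlock A ∈ symplectic n k := by
  rw [mem_symplectic_iff (A := A) (B := 0) (C := 0) (D := ((A⁻¹ : GL n k) : Matrix n n k)ᵀ) rfl]
  simp [← transpose_mul, -coe_units_inv]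

/-- The symplectic group is generated by the symmetric shears and the Levi subgroup. -/
theorem mem_of_shears_mem (S : Submonoid (GL (n ⊕ n) k))
    (hU : ∀ R : Matrix n n k, R.IsSymm → upperShear R ∈ S)
    (hL : ∀ R : Matrix n n k, R.IsSymm → lowerShear R ∈ S)
    (hA : ∀ A : GL n k, leviBlock A ∈ S) {g : GL (n ⊕ n) k} (hg : g ∈ symplectic n k) :
    g ∈ S := by
  have inv_upper : ∀ R : Matrix n n k, (upperShear R)⁻¹ = upperShear (-R) := fun R =>
    inv_eq_of_mul_eq_one_right (Units.ext (by simp [upperShear, fromBlocks_multiply]))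
  have inv_lower : ∀ R : Matrix n n k, (lowerShear R)⁻¹ = lowerShear (-R) := fun R =>
    inv_eq_of_mul_eq_one_right (Units.ext (by simp [lowerShear, fromBlocks_multiply]))
  -- upper triangular with identity diagonal block
  have h1 : ∀ (g : GL (n ⊕ n) k) (B D : Matrix n n k),
      (g : Matrix (n ⊕ n) (n ⊕ n) k) = fromBlocks 1 B 0 D → g ∈ symplectic n k → g ∈ S := by
    intro g B D h hg
    obtain ⟨-, h2, h3⟩ := (mem_symplectic_iff h).1 hg
    have hD : D = 1 := by simpa using h2
    subst hD
    have hB : B.IsSymm := by simpa [IsSymm] using h3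
    have : g = upperShear B := Units.ext h
    exact this ▸ hU B hB
  have h2 : ∀ (g : GL (n ⊕ n) k) (A : GL n k) (B D : Matrix n n k),
      (g : Matrix (n ⊕ n) (n ⊕ n) k) = fromBlocks (A : Matrix n n k) B 0 D →
      g ∈ symplectic n k → g ∈ S := by
    intro g A B D h hg
    have hmem : leviBlock A⁻¹ * g ∈ S := by
      refine h1 _ (((A⁻¹ : GL n k) : Matrix n n k) * B) ((A : Matrix n n k)ᵀ * D) ?_
        (Subgroup.mul_mem _ (leviBlock_mem_symplectic _) hg)
      rw [Units.val_mul, h]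
      simp [leviBlock, fromBlocks_multiply, -coe_units_inv]
    have e : g = leviBlock A * (leviBlock A⁻¹ * g) := by
      have : leviBlock A * leviBlock A⁻¹ = 1 := Units.ext (by
        simp [leviBlock, fromBlocks_multiply, ← transpose_mul, -coe_units_inv])
      rw [← mul_assoc, this, one_mul]
    rw [e]
    exact S.mul_mem (hA A) hmem
  -- Block elimination: CA⁻¹ is symmetric because AᵀC is, so a lower shear clears C.
  have h3 : ∀ (g : GL (n ⊕ n) k) (A : GL n k) (B C D : Matrix n n k),
      (g : Matrix (n ⊕ n) (n ⊕ n) k) = fromBlocks (A : Matrix n n k) B C D →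
      g ∈ symplectic n k → g ∈ S := by
    intro g A B C D h hg
    obtain ⟨hAC, -, -⟩ := (mem_symplectic_iff h).1 hg
    set A' : Matrix n n k := ((A⁻¹ : GL n k) : Matrix n n k) with hA'
    have hAA' : (A : Matrix n n k) * A' = 1 := by rw [hA', ← Units.val_mul, mul_inv_cancel]; rfl
    have hA'A : A' * (A : Matrix n n k) = 1 := by rw [hA', ← Units.val_mul, inv_mul_cancel]; rfl
    have hT : (C * A').IsSymm := by
      have ht : A'ᵀ * (A : Matrix n n k)ᵀ = 1 := by rw [← transpose_mul, hAA', transpose_one]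
      calc (C * A')ᵀ = A'ᵀ * Cᵀ := transpose_mul _ _
        _ = A'ᵀ * (Cᵀ * (A : Matrix n n k)) * A' := by
          rw [Matrix.mul_assoc, Matrix.mul_assoc, hAA', Matrix.mul_one]
        _ = A'ᵀ * ((A : Matrix n n k)ᵀ * C) * A' := by rw [hAC]
        _ = C * A' := by rw [← Matrix.mul_assoc A'ᵀ, ht, Matrix.one_mul]
    have hmem : lowerShear (-(C * A')) * g ∈ S := by
      refine h2 _ A B (-(C * A') * B + D) ?_
        (Subgroup.mul_mem _ (lowerShear_mem_symplectic hT.neg) hg)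
      rw [Units.val_mul, h]
      simp [lowerShear, fromBlocks_multiply, Matrix.mul_assoc, hA'A]
    have e : g = lowerShear (C * A') * (lowerShear (-(C * A')) * g) := by
      rw [← inv_lower, mul_inv_cancel_left]
    rw [e]
    exact S.mul_mem (hL _ hT) hmem
  obtain ⟨A, B, C, D, h⟩ : ∃ A B C D, (g : Matrix (n ⊕ n) (n ⊕ n) k) = fromBlocks A B C D :=
    ⟨_, _, _, _, (fromBlocks_toBlocks _).symm⟩
  obtain ⟨hAC, hAD, -⟩ := (mem_symplectic_iff h).1 hg
  -- A common kernel vector of A and C is zero by the transpose of AᵀD - CᵀB = 1.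
  obtain ⟨R, hR, hunit⟩ := exists_isSymm_isUnit_add_mul A C
    (by rw [IsSymm, transpose_mul, transpose_transpose, hAC])
    (fun v hAv hCv => by
      have := congrArg (fun M => Mᵀ *ᵥ v) hAD
      simpa [sub_mulVec, ← mulVec_mulVec, hAv, hCv, eq_comm] using this)
  obtain ⟨A', hA'⟩ := hunit
  have hmem : upperShear R * g ∈ S := by
    refine h3 _ A' (B + R * D) C D ?_ (Subgroup.mul_mem _ (upperShear_mem_symplectic hR) hg)
    rw [Units.val_mul, h, hA']
    simp [upperShear, fromBlocks_multiply]
  have e : g = upperShear (-R) * (upperShear R * g) := by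
    rw [← inv_upper, inv_mul_cancel_left]
  rw [e]
  exact S.mul_mem (hU _ hR.neg) hmem

theorem isZariskiDenseSubgroup_symplectic_rational [CharZero k] :
    IsZariskiDenseSubgroup (rationalPoints k (symplectic n ℚ)) (symplectic n k) := by
  -- Symmetric matrices are parametrized as x + xᵀ by free x; R is reached at x = R/2.
  have symm_half : ∀ R : Matrix n n k, R.IsSymm → ∀ i j, R i j = R i j / 2 + R j i / 2 := by
    intro R hR i j
    rw [hR.apply i j, add_halves]
  have symm_sum : ∀ x : n × n → ℚ, (Matrix.of fun i j => x (i, j) + x (j, i)).IsSymm := by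
    intro x
    ext i j
    simp [add_comm]
  refine isZariskiDenseSubgroup_of_le_hull rationalPoints_symplectic_le fun g hg =>
    mem_of_shears_mem _ (fun R hR => ?_) (fun R hR => ?_) (fun A => ?_) hg
  · refine mem_hull_rationalPoints_of_parametrization (τ := n × n) 1
      (fromBlocks 1 (Matrix.of fun i j => MvPolynomial.X (i, j) + MvPolynomial.X (j, i)) 0 1)
      (fun x _ => ⟨_, upperShear_mem_symplectic (symm_sum x), ?_⟩) _ (fun s => R s.1 s.2 / 2)
      (by simp) ?_
    · rintro (i | i) (j | j) <;> simp [upperShear, one_apply, apply_ite]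
    · rintro (i | i) (j | j) <;> simp [upperShear, one_apply, apply_ite, ← symm_half R hR]
  · refine mem_hull_rationalPoints_of_parametrization (τ := n × n) 1
      (fromBlocks 1 0 (Matrix.of fun i j => MvPolynomial.X (i, j) + MvPolynomial.X (j, i)) 1)
      (fun x _ => ⟨_, lowerShear_mem_symplectic (symm_sum x), ?_⟩) _ (fun s => R s.1 s.2 / 2)
      (by simp) ?_
    · rintro (i | i) (j | j) <;> simp [lowerShear, one_apply, apply_ite]
    · rintro (i | i) (j | j) <;> simp [lowerShear, one_apply, apply_ite, ← symm_half R hR]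
  · have hA0 : (A : Matrix n n k).det ≠ 0 :=
      ((isUnit_iff_isUnit_det _).1 A.isUnit).ne_zero
    have hentries : (Matrix.of fun i j => (A : Matrix n n k) (i, j).1 (i, j).2) = A := rfl
    refine mem_hull_rationalPoints_of_parametrization (τ := n × n) (mvPolynomialX n n k).det
      (fromBlocks ((mvPolynomialX n n k).det • mvPolynomialX n n k) 0 0
        (mvPolynomialX n n k).adjugateᵀ) (fun x hx => ?_) _ (fun s => (A : Matrix n n k) s.1 s.2)
      (by rwa [eval_mvPolynomialX_det, hentries]) ?_
    · rw [eval_mvPolynomialX_det] at hx ⊢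
      have hx' := hx
      rw [det_of_cast] at hx'
      refine ⟨leviBlock (GeneralLinearGroup.mkOfDetNeZero (Matrix.of fun i j => x (i, j))
        (by exact_mod_cast hx')), leviBlock_mem_symplectic _, ?_⟩
      have hadj : ∀ i j, (((Matrix.of fun i j => x (i, j)).adjugate i j : ℚ) : k) =
          (Matrix.of fun i j => (x (i, j) : k)).adjugate i j := by
        intro i j
        have := RingHom.map_adjugate (Rat.castHom k) (Matrix.of fun i j => x (i, j))
        exact congrFun (congrFun this i) j
      rintro (i | i) (j | j)
      · simp [leviBlock, GeneralLinearGroup.mkOfDetNeZero, eval_mvPolynomialX_det, hx]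
      · simp [leviBlock]
      · simp [leviBlock]
      · simp [leviBlock, GeneralLinearGroup.mkOfDetNeZero, eval_mvPolynomialX_adjugate, inv_def,
          hadj, det_of_cast, div_eq_inv_mul]
    · rw [eval_mvPolynomialX_det, hentries]
      rintro (i | i) (j | j)
      · simp [leviBlock, eval_mvPolynomialX_det, hentries, hA0]
      · simp [leviBlock]
      · simp [leviBlock]
      · simp [leviBlock, eval_mvPolynomialX_adjugate, hentries, inv_def, div_eq_inv_mul]

end Symplectic

/-! ### Compactness and the unitary trick over ℂ -/

section UnitaryTrick

open scoped ComplexOrder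

variable {n : Type*} [Fintype n] [DecidableEq n]

theorem mem_unitary_iff {g : GL n ℂ} :
    g ∈ unitary n ↔ (g : Matrix n n ℂ) * (g : Matrix n n ℂ)ᴴ = 1 := Iff.rfl

theorem isCompactEuclidean_inf_unitary (G : Subgroup (GL n ℂ)) {S : Set (Matrix n n ℂ)}
    (hS : IsClosed S) (h : ∀ g : GL n ℂ, g ∈ G ↔ (g : Matrix n n ℂ) ∈ S) :
    IsCompactEuclidean (G ⊓ unitary n) := by
  have himage : (fun M : GL n ℂ => (M : Matrix n n ℂ)) '' ((G ⊓ unitary n : Subgroup (GL n ℂ)) :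
      Set (GL n ℂ)) = S ∩ {M | M * Mᴴ = 1} := by
    ext M
    constructor
    · rintro ⟨g, ⟨hg, hgu⟩, rfl⟩
      exact ⟨(h g).1 hg, hgu⟩
    · rintro ⟨hM, hMu⟩
      exact ⟨⟨M, Mᴴ, hMu, mul_eq_one_comm.1 hMu⟩, ⟨(h _).2 hM, hMu⟩, rfl⟩
  rw [IsCompactEuclidean, himage]
  have hbox : IsCompact {M : Matrix n n ℂ | ∀ i, M i ∈ {v : n → ℂ | ∀ j, v j ∈
      Metric.closedBall (0 : ℂ) 1}} :=
    isCompact_pi_infinite fun _ => isCompact_pi_infinite fun _ => isCompact_closedBall 0 1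
  refine hbox.of_isClosed_subset (hS.inter ?_) ?_
  · exact isClosed_eq (by fun_prop) continuous_const
  · rintro M ⟨-, hM⟩ i j
    rw [mem_closedBall_zero_iff]
    exact entry_norm_bound_of_unitary (mem_unitaryGroup_iff.2 hM) i j

/-- The matrix `V diag(exp(z μ)) V*`. -/
noncomputable def unitaryExp (V : Matrix n n ℂ) (μ : n → ℝ) (z : ℂ) : Matrix n n ℂ :=
  V * diagonal (fun i => Complex.exp (z * μ i)) * Vᴴ

variable {V : Matrix n n ℂ} (hV : Vᴴ * V = 1) (μ : n → ℝ)

include hV in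
theorem unitaryExp_zero : unitaryExp V μ 0 = 1 := by
  simp [unitaryExp, mul_eq_one_comm.1 hV]

include hV in
theorem unitaryExp_mul (z w : ℂ) :
    unitaryExp V μ z * unitaryExp V μ w = unitaryExp V μ (z + w) := by
  calc unitaryExp V μ z * unitaryExp V μ w
      = V * diagonal (fun i => Complex.exp (z * μ i)) * (Vᴴ * V) *
          diagonal (fun i => Complex.exp (w * μ i)) * Vᴴ := by
        simp only [unitaryExp, Matrix.mul_assoc]
    _ = unitaryExp V μ (z + w) := by
        rw [hV, Matrix.mul_one, Matrix.mul_assoc V, diagonal_mul_diagonal, unitaryExp]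
        simp only [add_mul, Complex.exp_add]

theorem unitaryExp_conjTranspose (z : ℂ) :
    (unitaryExp V μ z)ᴴ = unitaryExp V μ (starRingEnd ℂ z) := by
  rw [unitaryExp, conjTranspose_mul, conjTranspose_mul, conjTranspose_conjTranspose,
    diagonal_conjTranspose, unitaryExp, Matrix.mul_assoc]
  congr 3
  ext i
  simp [← Complex.exp_conj]

/-- Spectral theorem for the positive definite g*g, with μ the logarithms of its eigenvalues. -/
theorem exists_conjTranspose_mul_self_eq_unitaryExp (g : GL n ℂ) :
    ∃ (V : Matrix n n ℂ) (μ : n → ℝ), Vᴴ * V = 1 ∧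
      (g : Matrix n n ℂ)ᴴ * (g : Matrix n n ℂ) = unitaryExp V μ 1 := by
  have hpos : ((g : Matrix n n ℂ)ᴴ * (g : Matrix n n ℂ)).PosDef :=
    PosDef.conjTranspose_mul_self _ (mulVec_injective_of_isUnit g.isUnit)
  refine ⟨hpos.1.eigenvectorUnitary, fun i => Real.log (hpos.1.eigenvalues i),
    UnitaryGroup.star_mul_self _, ?_⟩
  conv_lhs => rw [hpos.1.spectral_theorem]
  rw [Unitary.conjStarAlgAut_apply, unitaryExp]
  congr 3
  ext i
  rw [one_mul, ← Complex.ofReal_exp, Real.exp_log (hpos.eigenvalues_pos i)]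
  rfl

theorem differentiable_eval_entries {m : Type*} (p : MvPolynomial (m × m) ℂ)
    {F : ℂ → Matrix m m ℂ}
    (hF : ∀ i j, Differentiable ℂ fun z => F z i j) :
    Differentiable ℂ fun z => MvPolynomial.eval (entries (F z)) p := by
  induction p using MvPolynomial.induction_on with
  | C a => simp
  | add p q hp hq =>
    simp only [map_add]
    exact hp.add hq
  | mul_X p s hp =>
    simp only [map_mul, MvPolynomial.eval_X]
    exact hp.mul (hF s.1 s.2)

/-- **Unitary trick.** If a complex matrix group is closed under conjugate transposition and
under complex powers of its positive definite elements, its unitary part is Zariski-dense. -/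
theorem isZariskiDenseSubgroup_inf_unitary (G : Subgroup (GL n ℂ))
    (hstar : ∀ g ∈ G, ∃ h ∈ G, (h : Matrix n n ℂ) = (g : Matrix n n ℂ)ᴴ)
    (hexp : ∀ (V : Matrix n n ℂ) (μ : n → ℝ), Vᴴ * V = 1 →
      (∃ g ∈ G, (g : Matrix n n ℂ) = unitaryExp V μ 1) →
        ∀ z, ∃ g ∈ G, (g : Matrix n n ℂ) = unitaryExp V μ z) :
    IsZariskiDenseSubgroup (G ⊓ unitary n) G := by
  refine isZariskiDenseSubgroup_of_le_hull inf_le_left fun g hg p hp => ?_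
  obtain ⟨V, μ, hV, hgV⟩ := exists_conjTranspose_mul_self_eq_unitaryExp g
  obtain ⟨g', hg', hgg'⟩ := hstar g hg
  have hE := hexp V μ hV ⟨g' * g, G.mul_mem hg' hg, by rw [Units.val_mul, hgg', hgV]⟩
  set F : ℂ → Matrix n n ℂ := fun z => (g : Matrix n n ℂ) * unitaryExp V μ z with hF
  have hzero : ∀ y : ℝ, MvPolynomial.eval (entries (F (-(1 / 2) + y * Complex.I))) p = 0 := by
    intro y
    obtain ⟨e, he, hez⟩ := hE (-(1 / 2) + y * Complex.I)
    have hgz : ((g * e : GL n ℂ) : Matrix n n ℂ) = F (-(1 / 2) + y * Complex.I) := by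
      rw [Units.val_mul, hez]
    rw [← hgz]
    -- Here F(z)*F(z) = E(z̄) E(1) E(z) = E(1 + 2 Re z), which is E(0) = 1 on the line Re z = -1/2.
    refine hp _ ⟨G.mul_mem hg he, mem_unitary_iff.2 (mul_eq_one_comm.1 ?_)⟩
    rw [hgz, hF]
    simp only [conjTranspose_mul]
    rw [Matrix.mul_assoc, ← Matrix.mul_assoc _ (g : Matrix n n ℂ), hgV,
      unitaryExp_conjTranspose, unitaryExp_mul hV, unitaryExp_mul hV, ← unitaryExp_zero hV μ]
    congr 1
    apply Complex.ext <;> simp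
    norm_num
  have hdiff : Differentiable ℂ fun z => MvPolynomial.eval (entries (F z)) p := by
    refine differentiable_eval_entries p fun i j => ?_
    simp only [hF, unitaryExp, Matrix.mul_apply, diagonal_apply, mul_ite, mul_zero,
      Finset.sum_ite_eq', Finset.mem_univ, if_true]
    fun_prop
  -- The identity theorem needs zeros accumulating at -1/2 but different from it.
  have hline : Filter.Tendsto (fun y : ℝ => -(1 / 2) + (y : ℂ) * Complex.I)
      (nhdsWithin 0 {0}ᶜ) (nhdsWithin (-(1 / 2)) {-(1 / 2)}ᶜ) := by
    refine tendsto_nhdsWithin_iff.2 ⟨?_, ?_⟩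
    · have : Continuous fun y : ℝ => -(1 / 2) + (y : ℂ) * Complex.I := by fun_prop
      simpa using (this.tendsto 0).mono_left nhdsWithin_le_nhds
    · filter_upwards [self_mem_nhdsWithin] with y hy
      simpa using hy
  have hall := AnalyticOnNhd.eq_of_frequently_eq (z₀ := -(1 / 2))
    (fun z _ => hdiff.analyticAt z) (analyticOnNhd_const (v := (0 : ℂ)))
    (hline.frequently (Filter.Eventually.of_forall hzero).frequently)
  have h0 := congrFun hall 0
  simpa [hF, unitaryExp_zero hV] using h0

/-- `V diag(exp(z μ)) V*` as an invertible matrix. -/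
noncomputable def unitaryExpUnit (hV : Vᴴ * V = 1) (μ : n → ℝ) (z : ℂ) : GL n ℂ :=
  ⟨unitaryExp V μ z, unitaryExp V μ (-z),
    by rw [unitaryExp_mul hV, add_neg_cancel, unitaryExp_zero hV],
    by rw [unitaryExp_mul hV, neg_add_cancel, unitaryExp_zero hV]⟩

/-- The conjugate transpose of an invertible matrix, as an invertible matrix. -/
def conjTransposeUnit (g : GL n ℂ) : GL n ℂ :=
  ⟨(g : Matrix n n ℂ)ᴴ, ((g⁻¹ : GL n ℂ) : Matrix n n ℂ)ᴴ,
    by rw [← conjTranspose_mul, ← Units.val_mul, inv_mul_cancel, Units.val_one,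
      conjTranspose_one],
    by rw [← conjTranspose_mul, ← Units.val_mul, mul_inv_cancel, Units.val_one,
      conjTranspose_one]⟩

theorem isZariskiDenseSubgroup_generalLinear_inf_unitary :
    IsZariskiDenseSubgroup (generalLinear n ℂ ⊓ unitary n) (generalLinear n ℂ) :=
  isZariskiDenseSubgroup_inf_unitary _
    (fun g _ => ⟨conjTransposeUnit g, Subgroup.mem_top _, rfl⟩)
    fun _ μ hV _ z => ⟨unitaryExpUnit hV μ z, Subgroup.mem_top _, rfl⟩

include hV in
theorem det_unitaryExp (z : ℂ) : (unitaryExp V μ z).det = Complex.exp (z * ∑ i, (μ i : ℂ)) := by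
  rw [unitaryExp, det_mul_right_comm, mul_eq_one_comm.1 hV, Matrix.one_mul, det_diagonal,
    Finset.mul_sum, Complex.exp_sum]

/-- Since det E(z) = exp(z Σμ) and Σμ is real, det E(1) = 1 forces Σμ = 0, hence det E(z) = 1 for
all z. -/
theorem isZariskiDenseSubgroup_specialLinear_inf_unitary :
    IsZariskiDenseSubgroup (specialLinear n ℂ ⊓ unitary n) (specialLinear n ℂ) := by
  refine isZariskiDenseSubgroup_inf_unitary _ (fun g hg => ⟨conjTransposeUnit g, ?_, rfl⟩) ?_
  · have hg' : (g : Matrix n n ℂ).det = 1 := hg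
    change ((g : Matrix n n ℂ)ᴴ).det = 1
    rw [det_conjTranspose, hg', star_one]
  · rintro V μ hV ⟨g, hg, hgV⟩ z
    refine ⟨unitaryExpUnit hV μ z, ?_, rfl⟩
    have hdet : (unitaryExp V μ 1).det = 1 := hgV ▸ hg
    change (unitaryExp V μ z).det = 1
    rw [det_unitaryExp hV, one_mul, ← Complex.ofReal_sum, ← Complex.ofReal_exp] at hdet
    have hsum : ∑ i, μ i = 0 := (Real.exp_eq_one_iff _).1 (by exact_mod_cast hdet)
    rw [det_unitaryExp hV, ← Complex.ofReal_sum, hsum, Complex.ofReal_zero, mul_zero,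
      Complex.exp_zero]

include hV in
-- In the eigenbasis V, preserving B becomes the entrywise condition exp(z(μᵢ + μⱼ)) bᵢⱼ = bᵢⱼ.
theorem transpose_unitaryExp_mul_mul_iff (B : Matrix n n ℂ) (z : ℂ) :
    (unitaryExp V μ z)ᵀ * B * unitaryExp V μ z = B ↔
      diagonal (fun i => Complex.exp (z * μ i)) * (Vᵀ * B * V) *
        diagonal (fun i => Complex.exp (z * μ i)) = Vᵀ * B * V := by
  set D := diagonal (fun i => Complex.exp (z * μ i)) with hD
  have hV' : V * Vᴴ = 1 := mul_eq_one_comm.1 hV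
  have hVt : Vᵀ * Vᴴᵀ = 1 := by rw [← transpose_mul, hV, transpose_one]
  have hVt' : Vᴴᵀ * Vᵀ = 1 := by rw [← transpose_mul, hV', transpose_one]
  have hDt : Dᵀ = D := diagonal_transpose _
  have e : (unitaryExp V μ z)ᵀ * B * unitaryExp V μ z = Vᴴᵀ * (D * (Vᵀ * B * V) * D) * Vᴴ := by
    simp only [unitaryExp, ← hD, transpose_mul, hDt, Matrix.mul_assoc]
  rw [e]
  constructor
  · intro h
    calc D * (Vᵀ * B * V) * D
        = (Vᵀ * Vᴴᵀ) * (D * (Vᵀ * B * V) * D) * (Vᴴ * V) := by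
          rw [hVt, hV, Matrix.one_mul, Matrix.mul_one]
      _ = Vᵀ * (Vᴴᵀ * (D * (Vᵀ * B * V) * D) * Vᴴ) * V := by simp only [Matrix.mul_assoc]
      _ = Vᵀ * B * V := by rw [h]
  · intro h
    rw [h]
    calc Vᴴᵀ * (Vᵀ * B * V) * Vᴴ = (Vᴴᵀ * Vᵀ) * B * (V * Vᴴ) := by simp only [Matrix.mul_assoc]
      _ = B := by rw [hVt', hV', Matrix.one_mul, Matrix.mul_one]

theorem isZariskiDenseSubgroup_formStabilizer_inf_unitary (B : Matrix n n ℂ)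
    (hreal : B.map (starRingEnd ℂ) = B) (hsq : B * B = 1 ∨ B * B = -1) :
    IsZariskiDenseSubgroup (formStabilizer B ⊓ unitary n) (formStabilizer B) := by
  refine isZariskiDenseSubgroup_inf_unitary _ (fun g hg => ⟨conjTransposeUnit g, ?_, rfl⟩) ?_
  · have hg' : (g : Matrix n n ℂ)ᵀ * B * (g : Matrix n n ℂ) = B := hg
    -- As B⁻¹ = ±B, inverting gᵀBg = B yields gBgᵀ = B; conjugating, with B real, gives the equation
    -- for g*.
    obtain ⟨C, hBC, hC⟩ : ∃ C : Matrix n n ℂ, B * C = 1 ∧ (C = B ∨ C = -B) := by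
      rcases hsq with h | h
      · exact ⟨B, h, Or.inl rfl⟩
      · exact ⟨-B, by rw [mul_neg, h, neg_neg], Or.inr rfl⟩
    have hCB := mul_eq_one_comm.1 hBC
    have h1 : (g : Matrix n n ℂ) * C * (g : Matrix n n ℂ)ᵀ = C := by
      have h2 : (C * (g : Matrix n n ℂ)ᵀ * B) * (g : Matrix n n ℂ) = 1 := by
        rw [Matrix.mul_assoc, Matrix.mul_assoc, ← Matrix.mul_assoc (g : Matrix n n ℂ)ᵀ, hg', hCB]
      have h3 := mul_eq_one_comm.1 h2
      calc (g : Matrix n n ℂ) * C * (g : Matrix n n ℂ)ᵀ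
          = (g : Matrix n n ℂ) * (C * (g : Matrix n n ℂ)ᵀ * B) * C := by
            rw [← Matrix.mul_one ((g : Matrix n n ℂ) * C * (g : Matrix n n ℂ)ᵀ), ← hBC]
            simp only [Matrix.mul_assoc]
        _ = C := by rw [h3, Matrix.one_mul]
    have h4 : (g : Matrix n n ℂ) * B * (g : Matrix n n ℂ)ᵀ = B := by
      rcases hC with rfl | rfl
      · exact h1
      · simpa using h1
    change ((g : Matrix n n ℂ)ᴴ)ᵀ * B * (g : Matrix n n ℂ)ᴴ = B
    have h5 := congrArg (starRingEnd ℂ).mapMatrix h4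
    rw [map_mul, map_mul] at h5
    simp only [RingHom.mapMatrix_apply, hreal] at h5
    exact h5
  · rintro V μ hV ⟨g, hg, hgV⟩ z
    refine ⟨unitaryExpUnit hV μ z, (transpose_unitaryExp_mul_mul_iff hV μ B z).2 ?_, rfl⟩
    have hg' : (unitaryExp V μ 1)ᵀ * B * unitaryExp V μ 1 = B := hgV ▸ hg
    have h1 := (transpose_unitaryExp_mul_mul_iff hV μ B 1).1 hg'
    ext i j
    have h2 := congrFun (congrFun h1 i) j
    rw [mul_diagonal, diagonal_mul] at h2 ⊢
    set b := (Vᵀ * B * V) i j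
    rw [one_mul, one_mul, mul_right_comm, ← Complex.exp_add] at h2
    rw [mul_right_comm, ← Complex.exp_add, ← mul_add]
    -- Reality of μ enters here: exp(μᵢ + μⱼ) = 1 forces μᵢ + μⱼ = 0, so the condition at z = 1
    -- persists for every z.
    rcases mul_left_eq_self₀.1 h2 with h3 | h3
    · rw [← Complex.ofReal_add, ← Complex.ofReal_exp] at h3
      have hsum : μ i + μ j = 0 := (Real.exp_eq_one_iff _).1 (by exact_mod_cast h3)
      rw [← Complex.ofReal_add, hsum, Complex.ofReal_zero, mul_zero, Complex.exp_zero, one_mul]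
    · rw [h3, mul_zero]

theorem isCompactEuclidean_generalLinear_inf_unitary :
    IsCompactEuclidean (generalLinear n ℂ ⊓ unitary n) :=
  isCompactEuclidean_inf_unitary _ isClosed_univ fun _ =>
    iff_of_true (Subgroup.mem_top _) (Set.mem_univ _)

theorem isCompactEuclidean_specialLinear_inf_unitary :
    IsCompactEuclidean (specialLinear n ℂ ⊓ unitary n) :=
  isCompactEuclidean_inf_unitary _ (S := {M | M.det = 1})
    (isClosed_eq (by fun_prop) continuous_const) fun _ => Iff.rfl

theorem isCompactEuclidean_formStabilizer_inf_unitary (B : Matrix n n ℂ) :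
    IsCompactEuclidean (formStabilizer B ⊓ unitary n) :=
  isCompactEuclidean_inf_unitary _ (S := {M | Mᵀ * B * M = B})
    (isClosed_eq (by fun_prop) continuous_const) fun _ => Iff.rfl

theorem isZariskiDenseSubgroup_orthogonal_inf_unitary :
    IsZariskiDenseSubgroup (orthogonal n ℂ ⊓ unitary n) (orthogonal n ℂ) :=
  isZariskiDenseSubgroup_formStabilizer_inf_unitary 1 (by ext i j; simp [one_apply, apply_ite])
    (Or.inl (mul_one 1))

theorem isZariskiDenseSubgroup_symplectic_inf_unitary :
    IsZariskiDenseSubgroup (symplectic n ℂ ⊓ unitary (n ⊕ n)) (symplectic n ℂ) :=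
  isZariskiDenseSubgroup_formStabilizer_inf_unitary _
    (by ext (i | i) (j | j) <;> simp [one_apply, apply_ite])
    (Or.inr (by ext (i | i) (j | j) <;> simp [fromBlocks_multiply, one_apply]))

end UnitaryTrick

end ClassicalDensity

open ClassicalDensity in
theorem theorem6p1 (t : ℕ) (ht : 1 ≤ t) :
    -- (a) the compact group `G(ℂ) ∩ U(ℂ)` is Zariski-dense in `G(ℂ)`
    ((IsCompactEuclidean (generalLinear (Fin t) ℂ ⊓ unitary (Fin t)) ∧
        IsZariskiDenseSubgroup (generalLinear (Fin t) ℂ ⊓ unitary (Fin t))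
          (generalLinear (Fin t) ℂ)) ∧
      (IsCompactEuclidean (specialLinear (Fin t) ℂ ⊓ unitary (Fin t)) ∧
        IsZariskiDenseSubgroup (specialLinear (Fin t) ℂ ⊓ unitary (Fin t))
          (specialLinear (Fin t) ℂ)) ∧
      (IsCompactEuclidean (orthogonal (Fin t) ℂ ⊓ unitary (Fin t)) ∧
        IsZariskiDenseSubgroup (orthogonal (Fin t) ℂ ⊓ unitary (Fin t))
          (orthogonal (Fin t) ℂ)) ∧
      (IsCompactEuclidean (symplectic (Fin t) ℂ ⊓ unitary (Fin t ⊕ Fin t)) ∧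
        IsZariskiDenseSubgroup (symplectic (Fin t) ℂ ⊓ unitary (Fin t ⊕ Fin t))
          (symplectic (Fin t) ℂ))) ∧
    -- (b) `G(ℚ)` is Zariski-dense in `G(k)` for every field `k` of characteristic zero
    (∀ (k : Type*) [Field k] [CharZero k],
      IsZariskiDenseSubgroup (rationalPoints k (generalLinear (Fin t) ℚ))
        (generalLinear (Fin t) k) ∧
      IsZariskiDenseSubgroup (rationalPoints k (specialLinear (Fin t) ℚ))
        (specialLinear (Fin t) k) ∧
      IsZariskiDenseSubgroup (rationalPoints k (orthogonal (Fin t) ℚ))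
        (orthogonal (Fin t) k) ∧
      IsZariskiDenseSubgroup (rationalPoints k (symplectic (Fin t) ℚ))
        (symplectic (Fin t) k)) := by
  have : Nonempty (Fin t) := ⟨⟨0, ht⟩⟩
  exact ⟨⟨⟨isCompactEuclidean_generalLinear_inf_unitary,
        isZariskiDenseSubgroup_generalLinear_inf_unitary⟩,
      ⟨isCompactEuclidean_specialLinear_inf_unitary,
        isZariskiDenseSubgroup_specialLinear_inf_unitary⟩,
      ⟨isCompactEuclidean_formStabilizer_inf_unitary _,
        isZariskiDenseSubgroup_orthogonal_inf_unitary⟩,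
      ⟨isCompactEuclidean_formStabilizer_inf_unitary _,
        isZariskiDenseSubgroup_symplectic_inf_unitary⟩⟩,
    fun _ _ _ => ⟨isZariskiDenseSubgroup_generalLinear_rational,
      isZariskiDenseSubgroup_specialLinear_rational,
      isZariskiDenseSubgroup_orthogonal_rational,
      isZariskiDenseSubgroup_symplectic_rational⟩⟩
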